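/- Let $G=(S,T,E)$ be a finite bipartite graph with vertex set $V=S\sqcup T$. For a matching $M$ of $G$ (possibly empty), let $V(M)\subseteq V$ be the set of vertices covered by $M$, and let $B(M)=V(M)\,\Delta\, S$, where $\Delta$ denotes the symmetric difference. For families $\mathcal{A},\mathcal{B}$ of subsets of $V$ put \[\mathcal{A}\,\square\,\mathcal{B}=\{A\cup B : A\in\mathcal{A},\ B\in\mathcal{B},\ A\cap B=\emptyset\}.\] Let $M$ be a uniformly random matching of $G$, that is, chosen uniformly from the set of all matchings of $G$. Then for any two upward closed families $\mathcal{A},\mathcal{B}$ of subsets of $V$, \[\mathbb{P}(B(M)\in\mathcal{A}\,\square\,\mathcal{B})\le\mathbb{P}(B(M)\in\mathcal{A})\,\mathbb{P}(B(M)\in\mathcal{B}).\] -/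

import Mathlib

open scoped symmDiff

/-- The matchings of `G`. In Mathlib a matching is a subgraph `M` in which every vertex of
`M.verts` is incident with exactly one edge of `M`; so `M` is determined by its edges and
`M.verts` is the set of vertices covered by `M`. -/
abbrev Matching {V : Type*} (G : SimpleGraph V) : Type _ := {M : G.Subgraph // M.IsMatching}

instance Matching.instNonempty {V : Type*} (G : SimpleGraph V) : Nonempty (Matching G) :=
  ⟨⟨⊥, fun _ hv => absurd hv (Set.notMem_empty _)⟩⟩

/-- The law of a uniform random matching of a finite graph. -/
noncomputable def uniformMatching {V : Type*} [Finite V] (G : SimpleGraph V) :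
    PMF (Matching G) :=
  letI := Fintype.ofFinite (Matching G)
  PMF.uniformOfFintype (Matching G)

/-- `B(M) = V(M) ∆ S`. -/
def matchingSet {V : Type*} {G : SimpleGraph V} (S : Set V) (M : Matching G) : Set V :=
  M.1.verts ∆ S

/-- The disjoint occurrence `𝒜 □ ℬ` of two (increasing) events. -/
def disjointOccurrence {V : Type*} (𝒜 ℬ : Set (Set V)) : Set (Set V) :=
  {C | ∃ A ∈ 𝒜, ∃ B ∈ ℬ, A ∩ B = ∅ ∧ C = A ∪ B}

/-! Take two independent uniform matchings `M`, `N` and exchange them on a random set of components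
of `M ∪ N`; each exchange permutes the pairs, so uniformity is kept. For a fixed pair the exchange
is a point `ω` of a cube. Each component has at most one vertex of `B(M) \ B(N)` and at most one of
`B(N) \ B(M)`, so disjoint witnesses in `B` become certificates on disjoint sets of coordinates.
Reimer's butterfly theorem then bounds these `ω` by those where one matching satisfies `𝒜` and the
other `ℬ`. -/

section Reimer

/-! ### Reimer's butterfly theorem by linear algebra -/

variable {ι : Type*} [Fintype ι]

/-- The rows `cubeFactor z` have Gram matrix `cubeKernel`. -/
def cubeFactor (z : ι → Bool) (y : ι → Option Bool) : ℤ :=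
  ∏ i, if y i = none ∨ y i = some (z i) then 1 else 0

theorem cubeFactor_some (z w : ι → Bool) :
    cubeFactor z (fun i => some (w i)) = if z = w then 1 else 0 := by
  rw [cubeFactor]
  split_ifs with h
  · subst h; simp
  · obtain ⟨i, hi⟩ := Function.ne_iff.1 h
    exact Finset.prod_eq_zero (Finset.mem_univ i) (by simp [Ne.symm hi])

variable [DecidableEq ι]

/-- The tensor power of the positive definite matrix `!![2, 1; 1, 2]`, indexed by the cube. -/
def cubeKernel (z w : ι → Bool) : ℤ := ∏ i, if z i = w i then 2 else 1

/-- A vector supported on the points agreeing with `x` on `s`. -/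
def redVector (s : Finset ι) (x z : ι → Bool) : ℤ :=
  ∏ i, if i ∈ s then (if z i = x i then 3 else 0) else (if z i = x i then 1 else 2)

/-- A vector supported on the points differing from `x` everywhere outside `s`. -/
def yellowVector (s : Finset ι) (x w : ι → Bool) : ℤ :=
  ∏ i, if i ∈ s then (if w i = x i then 2 else -1) else (if w i = x i then 0 else 1)

/-- Coordinatewise, `!![2, 1; 1, 2]` maps `(2, -1)` to `(3, 0)` and `(0, 1)` to `(1, 2)`. -/
theorem sum_cubeKernel_mul_yellowVector (s : Finset ι) (x z : ι → Bool) :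
    ∑ w, cubeKernel z w * yellowVector s x w = redVector s x z := by
  simp only [cubeKernel, yellowVector, redVector, ← Finset.prod_mul_distrib]
  rw [← Fintype.piFinset_univ, Finset.sum_prod_piFinset Finset.univ
    (fun i (b : Bool) => (if z i = b then (2 : ℤ) else 1) *
      if i ∈ s then (if b = x i then 2 else -1) else (if b = x i then 0 else 1))]
  refine Finset.prod_congr rfl fun i _ => ?_
  rw [Fintype.sum_bool]
  cases z i <;> cases x i <;> by_cases h : i ∈ s <;> simp [h]

theorem eq_of_redVector_ne_zero {s : Finset ι} {x z : ι → Bool} (h : redVector s x z ≠ 0) :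
    ∀ i ∈ s, z i = x i := by
  intro i hi
  have := Finset.prod_ne_zero_iff.1 h i (Finset.mem_univ i)
  by_contra hne
  simp [hi, hne] at this

theorem ne_of_yellowVector_ne_zero {s : Finset ι} {x w : ι → Bool}
    (h : yellowVector s x w ≠ 0) : ∀ i ∉ s, w i ≠ x i := by
  intro i hi heq
  have := Finset.prod_ne_zero_iff.1 h i (Finset.mem_univ i)
  simp [hi, heq] at this

theorem redVector_cast_zmod_two (s : Finset ι) (x z : ι → Bool) :
    ((redVector s x z : ℤ) : ZMod 2) = if z = x then 1 else 0 := by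
  rw [redVector, Int.cast_prod]
  split_ifs with h
  · subst h
    refine Finset.prod_eq_one fun i _ => ?_
    by_cases hi : i ∈ s
    · simp only [hi, if_true]; decide
    · simp [hi]
  · obtain ⟨i, hi⟩ := Function.ne_iff.1 h
    refine Finset.prod_eq_zero (Finset.mem_univ i) ?_
    by_cases his : i ∈ s
    · simp [his, hi]
    · simp only [his, hi, if_false]; decide

theorem sum_cubeFactor_mul_cubeFactor (z w : ι → Bool) :
    ∑ y, cubeFactor z y * cubeFactor w y = cubeKernel z w := by
  simp only [cubeFactor, cubeKernel, ← Finset.prod_mul_distrib]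
  rw [← Fintype.piFinset_univ, Finset.sum_prod_piFinset Finset.univ
    (fun i (b : Option Bool) => (if b = none ∨ b = some (z i) then (1 : ℤ) else 0) *
      if b = none ∨ b = some (w i) then 1 else 0)]
  refine Finset.prod_congr rfl fun i _ => ?_
  rw [Fintype.sum_option, Fintype.sum_bool]
  cases z i <;> cases w i <;> simp

/-- `cubeKernel` is positive definite. -/
theorem eq_zero_of_sum_cubeKernel_eq_zero (c : (ι → Bool) → ℤ)
    (h : ∑ z, c z * ∑ w, cubeKernel z w * c w = 0) : c = 0 := by
  have key : ∑ z, c z * ∑ w, cubeKernel z w * c w = ∑ y, (∑ z, c z * cubeFactor z y) ^ 2 := by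
    simp only [← sum_cubeFactor_mul_cubeFactor, sq, Finset.mul_sum, Finset.sum_mul]
    rw [Finset.sum_comm]
    refine (Finset.sum_congr rfl fun w _ => Finset.sum_comm).trans ?_
    rw [Finset.sum_comm]
    refine Finset.sum_congr rfl fun y _ => ?_
    exact Finset.sum_congr rfl fun w _ => Finset.sum_congr rfl fun z _ => by ring
  rw [key, Finset.sum_eq_zero_iff_of_nonneg fun _ _ => sq_nonneg _] at h
  funext w
  simpa [cubeFactor_some] using h (fun i => some (w i)) (Finset.mem_univ _)

/-- Restricted to `X × X` the matrix is the identity mod 2, so its determinant is odd. -/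
theorem linearIndependent_redVector (X : Finset (ι → Bool)) (s : (ι → Bool) → Finset ι) :
    LinearIndependent ℤ fun x : X => redVector (s x) x.1 := by
  let U : Matrix X X ℤ := fun x z => redVector (s x) x z
  have hU : U.det ≠ 0 := by
    intro h
    have h1 : (Int.castRingHom (ZMod 2)).mapMatrix U = 1 := by
      ext x z
      rw [RingHom.mapMatrix_apply, Matrix.map_apply, Matrix.one_apply, eq_intCast,
        redVector_cast_zmod_two]
      simp only [Subtype.ext_iff, eq_comm]
    have h2 := (Int.castRingHom (ZMod 2)).map_det U
    rw [h1, h] at h2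
    simp at h2
  have := Matrix.linearIndependent_rows_of_det_ne_zero hU
  refine LinearIndependent.of_comp (LinearMap.funLeft ℤ ℤ (fun x : X => x.1)) ?_
  exact this

/-- **Reimer's butterfly theorem.** If every `x ∈ X` is the intersection of a cylinder in `A` fixing
the coordinates in `s x` and a cylinder in `B` fixing the other ones, then `X` is at most as large
as the intersection of `A` with the pointwise complement of `B`. -/
theorem card_le_card_inter_compl (X A B : Finset (ι → Bool)) (s : (ι → Bool) → Finset ι)
    (hA : ∀ x ∈ X, ∀ z, (∀ i ∈ s x, z i = x i) → z ∈ A)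
    (hB : ∀ x ∈ X, ∀ z, (∀ i ∉ s x, z i = x i) → z ∈ B) :
    X.card ≤ (Finset.univ.filter fun z : ι → Bool => z ∈ A ∧ (fun i => !z i) ∈ B).card := by
  set D := Finset.univ.filter fun z : ι → Bool => z ∈ A ∧ (fun i => !z i) ∈ B with hD
  have hli : LinearIndependent ℤ fun x : X => fun z : D => redVector (s x) x.1 z.1 := by
    rw [Fintype.linearIndependent_iff]
    intro a ha
    let c : (ι → Bool) → ℤ := fun w => ∑ x : X, a x * yellowVector (s x) x.1 w
    have hKc (z : ι → Bool) :
        ∑ w, cubeKernel z w * c w = ∑ x : X, a x * redVector (s x) x.1 z := by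
      simp only [c, ← sum_cubeKernel_mul_yellowVector, Finset.mul_sum]
      rw [Finset.sum_comm]
      exact Finset.sum_congr rfl fun _ _ => Finset.sum_congr rfl fun _ _ => by ring
    -- Every term of the quadratic form at `c` vanishes: on `D` by `ha`, off `A` because the red
    -- vectors do, and where the complement of `z` is not in `B` because the yellow ones do.
    have hc : c = 0 := by
      refine eq_zero_of_sum_cubeKernel_eq_zero c (Finset.sum_eq_zero fun z _ => ?_)
      rw [hKc]
      by_cases hz : z ∈ D
      · have := congrFun ha ⟨z, hz⟩
        simp only [Finset.sum_apply, Pi.smul_apply, smul_eq_mul, Pi.zero_apply] at this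
        rw [this, mul_zero]
      · by_cases hzA : z ∈ A
        · have hzB : (fun i => !z i) ∉ B := fun h => hz (by simp [hD, hzA, h])
          refine mul_eq_zero_of_left (Finset.sum_eq_zero fun x _ => ?_) _
          refine mul_eq_zero_of_right _ (not_not.1 fun hne => hzB (hB x.1 x.2 _ fun i hi => ?_))
          have := ne_of_yellowVector_ne_zero hne i hi
          revert this
          cases z i <;> cases x.1 i <;> simp
        · refine mul_eq_zero_of_right _ (Finset.sum_eq_zero fun x _ => ?_)
          exact mul_eq_zero_of_right _
            (not_not.1 fun hne => hzA (hA x.1 x.2 _ (eq_of_redVector_ne_zero hne)))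
    refine Fintype.linearIndependent_iff.1 (linearIndependent_redVector X s) a ?_
    funext z
    have := hKc z
    simp only [hc, Pi.zero_apply, mul_zero, Finset.sum_const_zero] at this
    simpa using this.symm
  simpa using hli.fintype_card_le_finrank

end Reimer

/-! ### Sources in an orientation -/

section Arrows

variable {V : Type*} {r : V → V → Prop}

/-- If every vertex has at most one incoming arrow, then a component has at most one vertex without incoming
arrow. -/
theorem eq_of_reflTransGen_of_no_incoming (hr : ∀ ⦃a b c⦄, r a c → r b c → a = b)
    {u v : V} (hu : ∀ a, ¬ r a u) (hv : ∀ a, ¬ r a v)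
    (h : Relation.ReflTransGen (fun a b => r a b ∨ r b a) u v) : u = v := by
  have hreach : Relation.ReflTransGen r u v := by
    clear hv
    induction h with
    | refl => exact .refl
    | tail _ hbc ih =>
      rcases hbc with hbc | hcb
      · exact ih.tail hbc
      -- A step against an arrow must retrace the last arrow of the directed path.
      · rcases Relation.ReflTransGen.cases_tail ih with rfl | ⟨d, hud, hdb⟩
        · exact absurd hcb (hu _)
        · rwa [hr hcb hdb]
  rcases Relation.ReflTransGen.cases_tail hreach with rfl | ⟨d, _, hdv⟩
  · rfl
  · exact absurd hdv (hv d)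

end Arrows

/-! ### Exchanging matchings on components -/

section Swap

variable {V : Type*} {G : SimpleGraph V}

theorem Matching.eq_of_adj (M : Matching G) {a b c : V} (hb : M.1.Adj a b) (hc : M.1.Adj a c) :
    b = c :=
  (M.2 (M.1.edge_vert hb)).unique hb hc

theorem Matching.mem_verts_iff (M : Matching G) (a : V) : a ∈ M.1.verts ↔ ∃ b, M.1.Adj a b :=
  ⟨fun h => (M.2 h).exists, fun ⟨_, h⟩ => M.1.edge_vert h⟩

/-- The graph on `V` whose edges are those of `M` and `N`. -/
def unionGraph (M N : Matching G) : SimpleGraph V := M.1.spanningCoe ⊔ N.1.spanningCoe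

theorem unionGraph_adj (M N : Matching G) (a b : V) :
    (unionGraph M N).Adj a b ↔ M.1.Adj a b ∨ N.1.Adj a b := Iff.rfl

/-- A component contains at most one vertex of `B(M) \ B(N)`. -/
theorem eq_of_mem_matchingSet_diff {S T : Set V} (hG : G.IsBipartiteWith S T)
    (M N : Matching G) {u v : V}
    (hu : u ∈ matchingSet S M) (hu' : u ∉ matchingSet S N)
    (hv : v ∈ matchingSet S M) (hv' : v ∉ matchingSet S N)
    (huv : (unionGraph M N).Reachable u v) : u = v := by
  have hdisj : ∀ a ∈ S, a ∉ T := fun a h h' => Set.disjoint_left.1 hG.disjoint h h'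
  have hadj : ∀ {a b}, G.Adj a b → (a ∈ S ↔ b ∉ S) := by
    intro a b hab
    rcases hG.mem_of_adj hab with ⟨h1, h2⟩ | ⟨h1, h2⟩
    · simp only [h1, true_iff]; exact fun h => hdisj _ h h2
    · simp only [h2, not_true, iff_false]; exact fun h => hdisj _ h h1
  -- Edges of `M` point into `S`, edges of `N` out of it; vertices of `B(M) \ B(N)` have no incoming
  -- arrow.
  let r : V → V → Prop := fun a b => (a ∉ S ∧ M.1.Adj a b) ∨ (a ∈ S ∧ N.1.Adj a b)
  have hsrc : ∀ w, w ∈ matchingSet S M → w ∉ matchingSet S N → ∀ a, ¬ r a w := by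
    intro w hw hw' a har
    simp only [matchingSet, Set.mem_symmDiff] at hw hw'
    rcases har with ⟨ha, h⟩ | ⟨ha, h⟩
    · have hwS : w ∈ S := by have := hadj h.adj_sub; tauto
      have : w ∈ M.1.verts := M.1.edge_vert h.symm
      tauto
    · have hwS : w ∉ S := (hadj h.adj_sub).1 ha
      have : w ∈ N.1.verts := N.1.edge_vert h.symm
      tauto
  refine eq_of_reflTransGen_of_no_incoming (r := r) ?_ (hsrc u hu hu') (hsrc v hv hv') ?_
  · rintro a b c (⟨ha, h⟩ | ⟨ha, h⟩) (⟨hb, h'⟩ | ⟨hb, h'⟩)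
    · exact M.eq_of_adj h.symm h'.symm
    · have := hadj h.adj_sub; have := hadj h'.adj_sub; tauto
    · have := hadj h.adj_sub; have := hadj h'.adj_sub; tauto
    · exact N.eq_of_adj h.symm h'.symm
  · rw [SimpleGraph.reachable_iff_reflTransGen] at huv
    refine Relation.ReflTransGen.mono (fun a b hab => ?_) _ _ huv
    by_cases ha : a ∈ S
    · rcases (unionGraph_adj M N a b).1 hab with h | h
      · exact Or.inr (Or.inl ⟨(hadj h.adj_sub).1 ha, h.symm⟩)
      · exact Or.inl (Or.inr ⟨ha, h⟩)
    · rcases (unionGraph_adj M N a b).1 hab with h | h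
      · exact Or.inl (Or.inl ⟨ha, h⟩)
      · have := hadj h.adj_sub
        exact Or.inr (Or.inr ⟨by tauto, h.symm⟩)

/-- A representative of the component of `a`. -/
noncomputable def componentRep (H : SimpleGraph V) (a : V) : V := (H.connectedComponentMk a).out

theorem reachable_of_componentRep_eq {H : SimpleGraph V} {a b : V}
    (h : componentRep H a = componentRep H b) : H.Reachable a b := by
  have := congrArg H.connectedComponentMk h
  simpa [componentRep, SimpleGraph.connectedComponentMk, Quot.out_eq] using
    SimpleGraph.ConnectedComponent.exact
      ((Quot.out_eq _).symm.trans (this.trans (Quot.out_eq _)))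

theorem componentRep_eq_of_adj {H : SimpleGraph V} {a b : V} (h : H.Adj a b) :
    componentRep H a = componentRep H b :=
  congrArg Quot.out (SimpleGraph.ConnectedComponent.sound h.reachable)

/-- The matching that follows `N` on the components of `M ∪ N` selected by `ω` and `M` on the
others. -/
def mixMatching (ω : V → Bool) (M N : Matching G) : Matching G :=
  ⟨{ verts := {a | if ω (componentRep (unionGraph M N) a) then a ∈ N.1.verts else a ∈ M.1.verts}
     Adj := fun a b => if ω (componentRep (unionGraph M N) a) then N.1.Adj a b else M.1.Adj a b
     adj_sub := fun {a b} h => by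
       split_ifs at h
       · exact h.adj_sub
       · exact h.adj_sub
     edge_vert := fun {a b} h => by
       simp only [Set.mem_ofPred_eq]
       split_ifs at h ⊢
       · exact N.1.edge_vert h
       · exact M.1.edge_vert h
     symm := ⟨fun a b h => by
       have hab : (unionGraph M N).Adj a b := by
         rw [unionGraph_adj]
         split_ifs at h
         · exact Or.inr h
         · exact Or.inl h
       rw [← componentRep_eq_of_adj hab]
       split_ifs at h ⊢
       · exact h.symm
       · exact h.symm⟩ },
   fun a ha => by
     simp only [Set.mem_ofPred_eq] at ha
     simp only
     split_ifs at ha ⊢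
     · exact N.2 ha
     · exact M.2 ha⟩

theorem mixMatching_adj (ω : V → Bool) (M N : Matching G) (a b : V) :
    (mixMatching ω M N).1.Adj a b ↔
      if ω (componentRep (unionGraph M N) a) then N.1.Adj a b else M.1.Adj a b := Iff.rfl

theorem mem_matchingSet_mixMatching (S : Set V) (ω : V → Bool) (M N : Matching G) (a : V) :
    a ∈ matchingSet S (mixMatching ω M N) ↔
      if ω (componentRep (unionGraph M N) a) then a ∈ matchingSet S N
        else a ∈ matchingSet S M := by
  have : a ∈ (mixMatching ω M N).1.verts ↔
      if ω (componentRep (unionGraph M N) a) then a ∈ N.1.verts else a ∈ M.1.verts := Iff.rfl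
  simp only [matchingSet, Set.mem_symmDiff, this]
  split_ifs <;> rfl

theorem Matching.ext_adj {M N : Matching G} (h : ∀ a b, M.1.Adj a b ↔ N.1.Adj a b) : M = N := by
  refine Subtype.ext (SimpleGraph.Subgraph.ext ?_ ?_)
  · ext a; simp only [Matching.mem_verts_iff, h]
  · ext a b; exact h a b

theorem unionGraph_mixMatching (ω : V → Bool) (M N : Matching G) :
    unionGraph (mixMatching ω M N) (mixMatching (fun a => !ω a) M N) = unionGraph M N := by
  ext a b
  simp only [unionGraph_adj, mixMatching_adj]
  cases ω (componentRep (unionGraph M N) a) <;> simp [or_comm]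

/-- Exchange the two matchings on the components of their union selected by `ω`. -/
def swapMatchings (ω : V → Bool) (p : Matching G × Matching G) : Matching G × Matching G :=
  (mixMatching ω p.1 p.2, mixMatching (fun a => !ω a) p.1 p.2)

theorem swapMatchings_involutive (ω : V → Bool) :
    Function.Involutive (swapMatchings (G := G) ω) := by
  rintro ⟨M, N⟩
  refine Prod.ext (Matching.ext_adj fun a b => ?_) (Matching.ext_adj fun a b => ?_) <;>
  · simp only [swapMatchings, mixMatching_adj, unionGraph_mixMatching]
    cases ω (componentRep (unionGraph M N) a) <;> simp

open Classical in
/-- The BK inequality for the exchanges of a fixed pair of matchings. -/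
theorem card_swap_disjointOccurrence_le [Fintype V] {S T : Set V} (hG : G.IsBipartiteWith S T)
    {𝒜 ℬ : Set (Set V)} (h𝒜 : IsUpperSet 𝒜) (hℬ : IsUpperSet ℬ)
    (p : Matching G × Matching G) :
    (Finset.univ.filter fun ω : V → Bool =>
        matchingSet S (swapMatchings ω p).1 ∈ disjointOccurrence 𝒜 ℬ).card ≤
      (Finset.univ.filter fun ω : V → Bool =>
        matchingSet S (swapMatchings ω p).1 ∈ 𝒜 ∧ matchingSet S (swapMatchings ω p).2 ∈ ℬ).card := by
  obtain ⟨M, N⟩ := p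
  let b : (V → Bool) → Set V := fun ω => matchingSet S (mixMatching ω M N)
  let ρ : V → V := componentRep (unionGraph M N)
  have hb : ∀ ω a, a ∈ b ω ↔ if ω (ρ a) then a ∈ matchingSet S N else a ∈ matchingSet S M :=
    fun ω a => mem_matchingSet_mixMatching S ω M N a
  have huniq : ∀ ω ω' ω'' : V → Bool, ∀ u v, u ∈ b ω → u ∉ b ω' → v ∈ b ω → v ∉ b ω'' →
      ρ u = ρ v → u = v := by
    intro ω ω' ω'' u v h1 h2 h3 h4 hρ
    have hreach := reachable_of_componentRep_eq hρ
    rw [hb] at h1 h2 h3 h4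
    rw [← hρ] at h3 h4
    cases hω : ω (ρ u) <;> cases hω' : ω' (ρ u) <;> cases hω'' : ω'' (ρ u) <;>
      simp only [hω, hω', hω'', if_true, if_false, Bool.false_eq_true] at h1 h2 h3 h4
    case false.true.true => exact eq_of_mem_matchingSet_diff hG M N h1 h2 h3 h4 hreach
    case true.false.false =>
      refine eq_of_mem_matchingSet_diff hG N M h1 h2 h3 h4 ?_
      rwa [unionGraph, sup_comm]
    all_goals first | exact absurd h1 h2 | exact absurd h3 h4
  have hchoice : ∀ ω : V → Bool, ∃ s : Finset V, b ω ∈ disjointOccurrence 𝒜 ℬ →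
      (∀ z : V → Bool, (∀ i ∈ s, z i = ω i) → b z ∈ 𝒜) ∧
      (∀ z : V → Bool, (∀ i ∉ s, z i = ω i) → b z ∈ ℬ) := by
    intro ω
    by_cases hω : b ω ∈ disjointOccurrence 𝒜 ℬ
    swap
    · exact ⟨∅, fun h => absurd h hω⟩
    obtain ⟨A, hA, B, hB, hAB, hC⟩ := hω
    -- Fix the components holding a vertex of `A` that some exchange removes. If a vertex of `B` in
    -- such a component could be lost, uniqueness would make it that vertex of `A`.
    refine ⟨Finset.univ.filter fun i => ∃ u ∈ A, ρ u = i ∧ ∃ ω', u ∉ b ω', fun _ => ⟨?_, ?_⟩⟩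
    · intro z hz
      refine h𝒜 (fun u hu => ?_) hA
      by_contra hne
      have huω : u ∈ b ω := hC ▸ Or.inl hu
      have := hz (ρ u) (by simpa using ⟨u, hu, rfl, z, hne⟩)
      rw [hb, ← this, ← hb] at huω
      exact hne huω
    · intro z hz
      refine hℬ (fun u hu => ?_) hB
      by_contra hne
      have huω : u ∈ b ω := hC ▸ Or.inr hu
      by_cases hs : ∃ v ∈ A, ρ v = ρ u ∧ ∃ ω', v ∉ b ω'
      · obtain ⟨v, hv, hvu, ω', hω'⟩ := hs
        have hvω : v ∈ b ω := hC ▸ Or.inl hv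
        have := huniq ω ω' z v u hvω hω' huω hne hvu
        exact Set.notMem_empty u (hAB ▸ ⟨this ▸ hv, hu⟩)
      · have := hz (ρ u) (by simpa using hs)
        rw [hb, ← this, ← hb] at huω
        exact hne huω
  choose s hs using hchoice
  -- Complementing `ω` yields the second matching of the exchanged pair.
  have := card_le_card_inter_compl (Finset.univ.filter fun ω => b ω ∈ disjointOccurrence 𝒜 ℬ)
    (Finset.univ.filter fun ω => b ω ∈ 𝒜) (Finset.univ.filter fun ω => b ω ∈ ℬ) s
    (fun ω hω z hz => by simpa using (hs ω (by simpa using hω)).1 z hz)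
    (fun ω hω z hz => by simpa using (hs ω (by simpa using hω)).2 z hz)
  simp only [Finset.mem_filter, Finset.mem_univ, true_and] at this
  exact this

/-- For fixed `ω` the exchange is a bijection on pairs, so each `ω` contributes the same count. -/
theorem sum_card_filter_swapMatchings [Fintype V] [DecidableEq V] [Fintype (Matching G)]
    (P : Matching G × Matching G → Prop) [DecidablePred P] :
    ∑ p, (Finset.univ.filter fun ω : V → Bool => P (swapMatchings ω p)).card =
      Fintype.card (V → Bool) * (Finset.univ.filter P).card := by
  simp only [Finset.card_filter]
  rw [Finset.sum_comm]
  refine (Finset.sum_congr rfl fun ω _ => Equiv.sum_comp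
    (swapMatchings_involutive (G := G) ω).toPerm fun p => if P p then 1 else 0).trans ?_
  simp

open Classical in
theorem card_disjointOccurrence_mul_card_le [Finite V] [Fintype (Matching G)] {S T : Set V}
    (hG : G.IsBipartiteWith S T) {𝒜 ℬ : Set (Set V)}
    (h𝒜 : IsUpperSet 𝒜) (hℬ : IsUpperSet ℬ) :
    (Finset.univ.filter fun M : Matching G => matchingSet S M ∈ disjointOccurrence 𝒜 ℬ).card *
        Fintype.card (Matching G) ≤
      (Finset.univ.filter fun M : Matching G => matchingSet S M ∈ 𝒜).card *
        (Finset.univ.filter fun M : Matching G => matchingSet S M ∈ ℬ).card := by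
  have := Fintype.ofFinite V
  have h1 := sum_card_filter_swapMatchings (G := G)
    fun p => matchingSet S p.1 ∈ disjointOccurrence 𝒜 ℬ
  have h2 := sum_card_filter_swapMatchings (G := G)
    fun p => matchingSet S p.1 ∈ 𝒜 ∧ matchingSet S p.2 ∈ ℬ
  have h3 : _ * _ ≤ _ * _ := h1 ▸ h2 ▸ Finset.sum_le_sum fun p _ =>
    card_swap_disjointOccurrence_le hG h𝒜 hℬ p
  have h4 := Nat.le_of_mul_le_mul_left h3 Fintype.card_pos
  rw [← Finset.univ_product_univ, Finset.filter_product (fun M => matchingSet S M ∈ 𝒜)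
    (fun M => matchingSet S M ∈ ℬ), Finset.card_product] at h4
  refine le_trans (le_of_eq ?_) h4
  rw [Finset.filter_product_left fun M : Matching G => matchingSet S M ∈ disjointOccurrence 𝒜 ℬ,
    Finset.card_product, Finset.card_univ]

end Swap

theorem theorem1 {V : Type*} [Finite V] (G : SimpleGraph V) (S T : Set V)
    (hG : G.IsBipartiteWith S T) (hST : S ∪ T = Set.univ)
    (𝒜 ℬ : Set (Set V)) (h𝒜 : IsUpperSet 𝒜) (hℬ : IsUpperSet ℬ) :
    (uniformMatching G).toOuterMeasure {M | matchingSet S M ∈ disjointOccurrence 𝒜 ℬ} ≤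
      (uniformMatching G).toOuterMeasure {M | matchingSet S M ∈ 𝒜} *
        (uniformMatching G).toOuterMeasure {M | matchingSet S M ∈ ℬ} := by
  classical
  let := Fintype.ofFinite (Matching G)
  have hcard := card_disjointOccurrence_mul_card_le hG h𝒜 hℬ
  have hn : (Fintype.card (Matching G) : ENNReal) ≠ 0 := by
    exact_mod_cast Fintype.card_ne_zero
  have hn' : (Fintype.card (Matching G) : ENNReal) ≠ ⊤ := ENNReal.natCast_ne_top _
  simp only [uniformMatching, PMF.toOuterMeasure_uniformOfFintype_apply, Set.coe_ofPred,
    Fintype.card_subtype]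
  rw [ENNReal.div_le_iff hn hn', mul_assoc, ENNReal.div_mul_cancel hn hn', mul_comm,
    ← mul_div_assoc, ENNReal.le_div_iff_mul_le (Or.inl hn) (Or.inl hn'),
    mul_comm (Finset.card _ : ENNReal) (Finset.card _)]
  exact_mod_cast hcard
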